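/- Corollary 5.5 (FCD corollary). All vector spaces, algebras and Hopf algebras are over $\mathbb{C}$, and $\otimes=\otimes_{\mathbb{C}}$. Let $U$ be a vector space of countable dimension (finite or countably infinite), let $\mathbb{C}[\partial]$ be the polynomial algebra in a formal variable $\partial$, and let $FCD(U)=S(U\otimes\mathbb{C}[\partial])$ be the symmetric algebra of the vector space $U\otimes\mathbb{C}[\partial]$, equipped with the unique derivation $\partial$ that satisfies $\partial(u\otimes p)=u\otimes \partial p$ for $u\in U$, $p\in\mathbb{C}[\partial]$ (this is the free commutative differential algebra over $U$). Let $H$ be a finite-dimensional Hopf algebra with comultiplication $\Delta(h)=\sum h_1\otimes h_2$, counit $\epsilon$ and antipode $S$. Suppose that $FCD(U)$ is an $H$-module such that (1) $FCD(U)$ is an $H$-module algebra, i.e. $h1=\epsilon(h)1$ and $h(ab)=\sum (h_1a)(h_2b)$ for all $h\in H$ and $a,b\in FCD(U)$; (2) $FCD(U)$ is inner faithful, i.e. $I\cdot FCD(U)\neq 0$ for every nonzero Hopf ideal $I$ of $H$ (a two-sided ideal $I$ with $\Delta(I)\subseteq H\otimes I+I\otimes H$, $\epsilon(I)=0$ and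 $S(I)\subseteq I$); (3) the actions of $H$ and $\partial$ commute, i.e. $h(\partial a)=\partial(ha)$ for all $h\in H$ and $a\in FCD(U)$. Then $H$ is a group algebra: there are a group $G$ and an isomorphism of Hopf algebras $\mathbb{C}[G]\cong H$. -/

import Mathlib

open scoped TensorProduct Polynomial

noncomputable section

namespace HopfAction

/-! ### The derivation of a symmetric algebra extending an endomorphism of the generators -/

section SymmetricAlgebra

variable {M : Type*} [AddCommGroup M] [Module ℂ M]

/-- For a linear endomorphism `f` of `M`, the algebra map `a ↦ a + D(a) ε` from `S(M)` to its dual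
numbers which is determined by `m ↦ m + f(m) ε` on generators. -/
def symDual (f : M →ₗ[ℂ] M) :
    SymmetricAlgebra ℂ M →ₐ[ℂ] TrivSqZeroExt (SymmetricAlgebra ℂ M) (SymmetricAlgebra ℂ M) :=
  SymmetricAlgebra.lift
    ((TrivSqZeroExt.inlAlgHom ℂ (SymmetricAlgebra ℂ M) (SymmetricAlgebra ℂ M)).toLinearMap ∘ₗ
        SymmetricAlgebra.ι ℂ M +
      (TrivSqZeroExt.inrHom (SymmetricAlgebra ℂ M) (SymmetricAlgebra ℂ M)).restrictScalars ℂ ∘ₗ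
        SymmetricAlgebra.ι ℂ M ∘ₗ f)

lemma fst_symDual (f : M →ₗ[ℂ] M) (a : SymmetricAlgebra ℂ M) : (symDual f a).fst = a := by
  have h : (TrivSqZeroExt.fstHom ℂ (SymmetricAlgebra ℂ M) (SymmetricAlgebra ℂ M)).comp (symDual f)
      = AlgHom.id ℂ _ := by
    apply SymmetricAlgebra.algHom_ext
    ext m
    simp [symDual]
  exact DFunLike.congr_fun h a

/-- The derivation of the symmetric algebra `S(M)` which extends the endomorphism `f` of `M`. -/
def symDerivation (f : M →ₗ[ℂ] M) :
    Derivation ℂ (SymmetricAlgebra ℂ M) (SymmetricAlgebra ℂ M) :=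
  Derivation.mk'
    ((TrivSqZeroExt.sndHom (SymmetricAlgebra ℂ M) (SymmetricAlgebra ℂ M)).restrictScalars ℂ ∘ₗ
      (symDual f).toLinearMap)
    (by
      intro a b
      simp [fst_symDual, mul_comm])

@[simp] lemma symDerivation_ι (f : M →ₗ[ℂ] M) (m : M) :
    symDerivation f (SymmetricAlgebra.ι ℂ M m) = SymmetricAlgebra.ι ℂ M (f m) := by
  simp [symDerivation, symDual]

end SymmetricAlgebra

/-! ### The free commutative differential algebra over a vector space -/

section FCD

variable (U : Type*) [AddCommGroup U] [Module ℂ U]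

/-- `FCD(U) = S(U ⊗ ℂ[∂])`; the formal variable `∂` is the polynomial variable. -/
abbrev FCD : Type _ := SymmetricAlgebra ℂ (U ⊗[ℂ] ℂ[X])

/-- The derivation `∂` of `FCD(U)`: the one extending `u ⊗ p ↦ u ⊗ ∂ p` on generators. -/
def FCD.deriv : Derivation ℂ (FCD U) (FCD U) :=
  symDerivation (LinearMap.lTensor U (LinearMap.mulLeft ℂ (Polynomial.X : ℂ[X])))

lemma FCD.deriv_ι_tmul (u : U) (p : ℂ[X]) :
    FCD.deriv U (SymmetricAlgebra.ι ℂ _ (u ⊗ₜ[ℂ] p)) =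
      SymmetricAlgebra.ι ℂ _ (u ⊗ₜ[ℂ] (Polynomial.X * p)) := by
  simp [FCD.deriv]

end FCD

/-! ### Hopf actions -/

section Action

variable {H : Type*} [Ring H] [HopfAlgebra ℂ H]

/-- The `H`-module structure `ρ` on `A` makes `A` an `H`-module algebra:
`h 1 = ε(h) 1` and `h (a b) = ∑ (h₁ a) (h₂ b)`. -/
structure IsModuleAlgebra {A : Type*} [Ring A] [Algebra ℂ A]
    (ρ : H →ₐ[ℂ] Module.End ℂ A) : Prop where
  map_one : ∀ h : H, ρ h 1 = Coalgebra.counit (R := ℂ) h • (1 : A)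
  map_mul : ∀ (h : H) (a b : A),
    ρ h (a * b) = LinearMap.mul' ℂ A
      (TensorProduct.map (ρ.toLinearMap.flip a) (ρ.toLinearMap.flip b)
        (Coalgebra.comul (R := ℂ) h))

/-- The `H`-module structure `ρ` on `M` is inner faithful: `I M ≠ 0` for every nonzero Hopf
ideal `I` of `H`. -/
def IsInnerFaithful {M : Type*} [AddCommGroup M] [Module ℂ M]
    (ρ : H →ₐ[ℂ] Module.End ℂ M) : Prop :=
  ∀ I : Ideal H, I.IsTwoSided → I.IsHopfIdeal ℂ → I ≠ ⊥ → ∃ h ∈ I, ∃ m : M, ρ h m ≠ 0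

end Action

/-- The Hopf algebra `H` is a group algebra: it is isomorphic, as a Hopf algebra, to `ℂ[G]` with
its standard Hopf algebra structure, for some group `G`. -/
def IsGroupAlgebra.{u} (H : Type u) [Ring H] [HopfAlgebra ℂ H] : Prop :=
  ∃ (G : Type u) (_ : Group G) (e : MonoidAlgebra ℂ G ≃ₐc[ℂ] H),
    ∀ a, e (HopfAlgebra.antipode ℂ a) = HopfAlgebra.antipode ℂ (e a)

end HopfAction

end

/-! Applying h to ∂ⁿ(a)b = b∂ⁿ(a) and moving ∂ⁿ past H gives ∑ ∂ⁿ(h₁a)(h₂b) = ∑ ∂ⁿ(h₂a)(h₁b) for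
every n. By `FCD.nondegenerate` these products determine a tensor, so ∑ h₁a ⊗ h₂b = ∑ h₂a ⊗ h₁b: the
matrix coefficients of the action commute in H*. Nondegeneracy is interpolation: a tensor sees only
finite jets, any two points of FCD(U) have the same finite jets as the values at 1 and 0 of one
polynomial curve, and Taylor's formula expresses the value at 1 through derivatives at 0.

The common zeros of the algebra generated by the coefficients form a bi-ideal, hence a Hopf ideal
since H is finite-dimensional (`isHopfIdeal_of_isCoideal`). It kills FCD(U), so inner faithfulness
makes it zero; the coefficients then separate the points of H, and H is cocommutative.

It remains to prove Cartier's theorem, `span_groupLike_eq_top`. The commutative algebra H* has zero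
Jacobson radical, because a nonzero tangent vector at a character would yield a nonzero primitive
element. Its characters are the group-likes, which therefore span H. -/

namespace HopfAction

open Polynomial

/-- Functionals separating the points of `V` and functionals separating the points of `W` jointly
separate the points of `V ⊗ W`. -/
lemma tensor_eq_zero_of_separating {K V W : Type*} [Field K] [AddCommGroup V] [Module K V]
    [AddCommGroup W] [Module K W] {Φ : Set (V →ₗ[K] K)} {Ψ : Set (W →ₗ[K] K)}
    (hΦ : ∀ v, (∀ φ ∈ Φ, φ v = 0) → v = 0) (hΨ : ∀ w, (∀ ψ ∈ Ψ, ψ w = 0) → w = 0)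
    (T : V ⊗[K] W)
    (hT : ∀ φ ∈ Φ, ∀ ψ ∈ Ψ, LinearMap.mul' K K (TensorProduct.map φ ψ T) = 0) : T = 0 := by
  classical
  let b := Module.Basis.ofVectorSpace K W
  let e := TensorProduct.equivFinsuppOfBasisRight (M := V) b
  have key : ∀ φ ∈ Φ, TensorProduct.lid K W (LinearMap.rTensor W φ T) = 0 := by
    intro φ hφ
    apply hΨ
    intro ψ hψ
    rw [← hT φ hφ ψ hψ]
    clear hT
    induction T with
    | zero => simp
    | tmul v w => simp
    | add x y hx hy => simp_all
  have hcoord : ∀ φ : V →ₗ[K] K, ∀ i, φ (e T i) =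
      b.repr (TensorProduct.lid K W (LinearMap.rTensor W φ T)) i := by
    intro φ i
    generalize T = S
    induction S with
    | zero => simp
    | tmul v w => simp [e, mul_comm]
    | add x y hx hy => simp_all
  apply e.injective
  ext i
  rw [map_zero, Finsupp.zero_apply]
  apply hΦ
  intro φ hφ
  rw [hcoord, key φ hφ]
  simp

/-! ### Hermite interpolation and Taylor expansion of polynomials. -/

section Jets

lemma iterate_derivative_eval_eq_of_dvd {p q : ℂ[X]} {r : ℂ} {K : ℕ}
    (h : (X - C r) ^ K ∣ p - q) {k : ℕ} (hk : k < K) :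
    (derivative^[k] p).eval r = (derivative^[k] q).eval r := by
  have h1 : (X - C r) ^ (K - k) ∣ derivative^[k] (p - q) :=
    pow_sub_dvd_iterate_derivative_of_pow_dvd k h
  have h2 : X - C r ∣ derivative^[k] (p - q) :=
    (dvd_pow_self _ (by omega)).trans h1
  rw [dvd_iff_isRoot, IsRoot, iterate_derivative_sub, eval_sub, sub_eq_zero] at h2
  exact h2

lemma exists_jet (r : ℂ) (K : ℕ) (c : ℕ → ℂ) :
    ∃ p : ℂ[X], ∀ k < K, (derivative^[k] p).eval r = c k := by
  refine ⟨∑ j ∈ Finset.range K, C (c j / (j.factorial : ℂ)) * (X - C r) ^ j, fun k hk => ?_⟩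
  rw [iterate_derivative_sum, eval_finsetSum, Finset.sum_eq_single k]
  · have : (k.factorial : ℂ) ≠ 0 := by exact_mod_cast k.factorial_ne_zero
    rw [iterate_derivative_C_mul, iterate_derivative_X_sub_pow]
    simp [Nat.descFactorial_self, this]
  · intro j _ hjk
    rw [iterate_derivative_C_mul, iterate_derivative_X_sub_pow]
    rcases lt_or_gt_of_ne hjk with h | h
    · simp [Nat.descFactorial_of_lt h]
    · simp [Nat.sub_ne_zero_of_lt h]
  · intro h
    exact absurd (Finset.mem_range.2 hk) h

/-- Hermite interpolation at two points. -/
lemma exists_two_jets (K : ℕ) (c d : ℕ → ℂ) :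
    ∃ f : ℂ[X], ∀ k < K, (derivative^[k] f).eval 1 = c k ∧ (derivative^[k] f).eval 0 = d k := by
  obtain ⟨p, hp⟩ := exists_jet 1 K c
  obtain ⟨q, hq⟩ := exists_jet 0 K d
  have hcop : IsCoprime ((X - C (1 : ℂ)) ^ K) ((X - C (0 : ℂ)) ^ K) :=
    (isCoprime_X_sub_C_of_isUnit_sub (by simp)).pow
  obtain ⟨u, v, huv⟩ := hcop
  -- By `huv` this is congruent to p modulo (X - 1)ᴷ and to q modulo Xᴷ.
  refine ⟨q * (u * (X - C (1 : ℂ)) ^ K) + p * (v * (X - C (0 : ℂ)) ^ K), fun k hk => ⟨?_, ?_⟩⟩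
  · rw [← hp k hk]
    exact iterate_derivative_eval_eq_of_dvd ⟨(q - p) * u, by linear_combination p * huv⟩ hk
  · rw [← hq k hk]
    exact iterate_derivative_eval_eq_of_dvd ⟨(p - q) * v, by linear_combination q * huv⟩ hk

lemma eval_one_eq_sum_iterate_derivative (p : ℂ[X]) {N : ℕ} (hN : p.natDegree < N) :
    p.eval 1 = ∑ n ∈ Finset.range N, (n.factorial : ℂ)⁻¹ * (derivative^[n] p).eval 0 := by
  rw [eval_eq_sum_range' hN]
  refine Finset.sum_congr rfl fun n _ => ?_
  have : (n.factorial : ℂ) ≠ 0 := by exact_mod_cast n.factorial_ne_zero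
  rw [← coeff_zero_eq_eval_zero, coeff_iterate_derivative]
  simp [Nat.descFactorial_self, this]

end Jets

/-! ### Points of FCD(U) and nondegeneracy. -/

section Points

variable {U : Type*} [AddCommGroup U] [Module ℂ U]

/-- The differential algebra map `FCD(U) → ℂ[X]` determined by a linear map on `U`. -/
noncomputable def FCD.toPolynomial (g : U →ₗ[ℂ] ℂ[X]) : FCD U →ₐ[ℂ] ℂ[X] :=
  SymmetricAlgebra.lift (TensorProduct.lift
    ((aeval (derivative : Module.End ℂ ℂ[X])).toLinearMap.flip ∘ₗ g))

lemma FCD.toPolynomial_ι_tmul (g : U →ₗ[ℂ] ℂ[X]) (u : U) (p : ℂ[X]) :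
    FCD.toPolynomial g (SymmetricAlgebra.ι ℂ _ (u ⊗ₜ[ℂ] p)) =
      aeval (derivative : Module.End ℂ ℂ[X]) p (g u) := by
  simp [FCD.toPolynomial]

lemma FCD.toPolynomial_deriv (g : U →ₗ[ℂ] ℂ[X]) (a : FCD U) :
    FCD.toPolynomial g (FCD.deriv U a) = derivative (FCD.toPolynomial g a) := by
  induction a using SymmetricAlgebra.induction with
  | algebraMap r => simp
  | ι m =>
    induction m with
    | zero => simp
    | tmul u p => simp [FCD.deriv_ι_tmul, FCD.toPolynomial_ι_tmul]
    | add x y hx hy => simp_all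
  | mul a b ha hb => simp [Derivation.leibniz, ha, hb, derivative_mul]; ring
  | add a b ha hb => simp [ha, hb]

lemma FCD.toPolynomial_iterate_deriv (g : U →ₗ[ℂ] ℂ[X]) (n : ℕ) (a : FCD U) :
    FCD.toPolynomial g ((FCD.deriv U)^[n] a) = derivative^[n] (FCD.toPolynomial g a) := by
  induction n generalizing a with
  | zero => rfl
  | succ n ih => rw [Function.iterate_succ_apply, Function.iterate_succ_apply, ih,
      FCD.toPolynomial_deriv]

/-- The generators `u ⊗ ∂ᵏ` of `FCD(U)`. -/
noncomputable def FCD.jet (k : ℕ) : U →ₗ[ℂ] FCD U :=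
  SymmetricAlgebra.ι ℂ _ ∘ₗ (TensorProduct.mk ℂ U ℂ[X]).flip (X ^ k)

lemma FCD.jet_apply (k : ℕ) (u : U) :
    FCD.jet k u = SymmetricAlgebra.ι ℂ _ (u ⊗ₜ[ℂ] (X ^ k : ℂ[X])) := rfl

/-- Every element of `FCD(U)` involves only finitely many derivatives of the elements of `U`. -/
lemma FCD.exists_order (a : FCD U) :
    ∃ K : ℕ, ∀ φ φ' : FCD U →ₐ[ℂ] ℂ,
      (∀ (u : U), ∀ k < K, φ (FCD.jet k u) =
        φ' (FCD.jet k u)) → φ a = φ' a := by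
  have comb : ∀ {K L : ℕ} {P : ℕ → Prop}, (∀ k < max K L, P k) →
      (∀ k < K, P k) ∧ ∀ k < L, P k := fun h =>
    ⟨fun k hk => h k (lt_max_of_lt_left hk), fun k hk => h k (lt_max_of_lt_right hk)⟩
  induction a using SymmetricAlgebra.induction with
  | algebraMap r => exact ⟨0, fun φ φ' _ => by simp⟩
  | ι m =>
    induction m with
    | zero => exact ⟨0, fun φ φ' _ => by simp⟩
    | tmul u p =>
      refine ⟨p.natDegree + 1, fun φ φ' h => ?_⟩
      rw [p.as_sum_range_C_mul_X_pow]
      simp only [← smul_eq_C_mul, TensorProduct.tmul_sum, TensorProduct.tmul_smul, map_sum,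
        map_smul]
      exact Finset.sum_congr rfl fun k hk => by rw [← FCD.jet_apply, h u k (Finset.mem_range.1 hk)]
    | add x y hx hy =>
      obtain ⟨K, hK⟩ := hx
      obtain ⟨L, hL⟩ := hy
      refine ⟨max K L, fun φ φ' h => ?_⟩
      simp only [map_add]
      rw [hK φ φ' fun u => (comb (h u)).1, hL φ φ' fun u => (comb (h u)).2]
  | mul a b ha hb =>
    obtain ⟨K, hK⟩ := ha
    obtain ⟨L, hL⟩ := hb
    refine ⟨max K L, fun φ φ' h => ?_⟩
    rw [map_mul, map_mul, hK φ φ' fun u => (comb (h u)).1, hL φ φ' fun u => (comb (h u)).2]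
  | add a b ha hb =>
    obtain ⟨K, hK⟩ := ha
    obtain ⟨L, hL⟩ := hb
    refine ⟨max K L, fun φ φ' h => ?_⟩
    rw [map_add, map_add, hK φ φ' fun u => (comb (h u)).1, hL φ φ' fun u => (comb (h u)).2]

lemma FCD.exists_order_tensor (T : FCD U ⊗[ℂ] FCD U) :
    ∃ K : ℕ, ∀ φ φ' ψ ψ' : FCD U →ₐ[ℂ] ℂ,
      (∀ (u : U), ∀ k < K, φ (FCD.jet k u) =
        φ' (FCD.jet k u)) →
      (∀ (u : U), ∀ k < K, ψ (FCD.jet k u) =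
        ψ' (FCD.jet k u)) →
      LinearMap.mul' ℂ ℂ (TensorProduct.map φ.toLinearMap ψ.toLinearMap T) =
        LinearMap.mul' ℂ ℂ (TensorProduct.map φ'.toLinearMap ψ'.toLinearMap T) := by
  induction T with
  | zero => exact ⟨0, fun _ _ _ _ _ _ => by simp⟩
  | tmul a b =>
    obtain ⟨K, hK⟩ := FCD.exists_order a
    obtain ⟨L, hL⟩ := FCD.exists_order b
    refine ⟨max K L, fun φ φ' ψ ψ' h h' => ?_⟩
    simp [hK φ φ' fun u k hk => h u k (lt_max_of_lt_left hk),
      hL ψ ψ' fun u k hk => h' u k (lt_max_of_lt_right hk)]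
  | add x y hx hy =>
    obtain ⟨K, hK⟩ := hx
    obtain ⟨L, hL⟩ := hy
    refine ⟨max K L, fun φ φ' ψ ψ' h h' => ?_⟩
    rw [map_add, map_add, map_add, map_add,
      hK φ φ' ψ ψ' (fun u k hk => h u k (lt_max_of_lt_left hk))
        fun u k hk => h' u k (lt_max_of_lt_left hk),
      hL φ φ' ψ ψ' (fun u k hk => h u k (lt_max_of_lt_right hk))
        fun u k hk => h' u k (lt_max_of_lt_right hk)]

/-- The `ℂ`-points of a symmetric algebra over `ℂ` separate its elements. -/
lemma symmetricAlgebra_eq_zero_of_points {M : Type*} [AddCommGroup M] [Module ℂ M]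
    (a : SymmetricAlgebra ℂ M) (h : ∀ φ : SymmetricAlgebra ℂ M →ₐ[ℂ] ℂ, φ a = 0) : a = 0 := by
  let e := SymmetricAlgebra.equivMvPolynomial (Module.Basis.ofVectorSpace ℂ M)
  apply e.injective
  rw [map_zero]
  apply MvPolynomial.funext
  intro x
  simpa [MvPolynomial.aeval_def, MvPolynomial.eval₂_eq_eval_map] using
    h ((MvPolynomial.aeval x).comp e.toAlgHom)

/-- Taylor expansion of the pairing `a ⊗ b ↦ χ(a)(1) χ(b)(0)`. -/
lemma FCD.eval_one_tensor_eval_zero (g : U →ₗ[ℂ] ℂ[X]) (T : FCD U ⊗[ℂ] FCD U) :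
    ∃ N₀ : ℕ, ∀ N, N₀ < N →
      LinearMap.mul' ℂ ℂ (TensorProduct.map
        ((aeval (1 : ℂ)).comp (FCD.toPolynomial g)).toLinearMap
        ((aeval (0 : ℂ)).comp (FCD.toPolynomial g)).toLinearMap T) =
      ∑ n ∈ Finset.range N, (n.factorial : ℂ)⁻¹ *
        (FCD.toPolynomial g (LinearMap.mul' ℂ (FCD U)
          (LinearMap.rTensor (FCD U) ((FCD.deriv U).toLinearMap ^ n) T))).eval 0 := by
  induction T with
  | zero => exact ⟨0, fun _ _ => by simp⟩
  | tmul a b =>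
    refine ⟨(FCD.toPolynomial g a).natDegree, fun N hN => ?_⟩
    have := eval_one_eq_sum_iterate_derivative _ hN
    simp only [TensorProduct.map_tmul, AlgHom.toLinearMap_apply, AlgHom.comp_apply,
      LinearMap.mul'_apply, LinearMap.rTensor_tmul, map_mul, eval_mul, Module.End.pow_apply,
      coe_aeval_eq_eval, Derivation.coeFn_coe, FCD.toPolynomial_iterate_deriv, ← mul_assoc]
    rw [← Finset.sum_mul, this]
  | add x y hx hy =>
    obtain ⟨K, hK⟩ := hx
    obtain ⟨L, hL⟩ := hy
    refine ⟨max K L, fun N hN => ?_⟩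
    simp only [map_add, eval_add, mul_add, Finset.sum_add_distrib]
    rw [hK N (lt_of_le_of_lt (le_max_left _ _) hN), hL N (lt_of_le_of_lt (le_max_right _ _) hN)]

/-- `FCD(U)` is nondegenerate: the map `a ⊗ b ↦ (∂ⁿ(a) b)ₙ` is injective. -/
theorem FCD.nondegenerate (T : FCD U ⊗[ℂ] FCD U)
    (hT : ∀ n, LinearMap.mul' ℂ (FCD U)
      (LinearMap.rTensor (FCD U) ((FCD.deriv U).toLinearMap ^ n) T) = 0) : T = 0 := by
  let Φ : Set (FCD U →ₗ[ℂ] ℂ) := Set.range fun φ : FCD U →ₐ[ℂ] ℂ => φ.toLinearMap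
  have hΦ : ∀ a, (∀ φ ∈ Φ, φ a = 0) → a = 0 := fun a h =>
    symmetricAlgebra_eq_zero_of_points a fun φ => h _ ⟨φ, rfl⟩
  refine tensor_eq_zero_of_separating hΦ hΦ T ?_
  rintro _ ⟨φ, rfl⟩ _ ⟨ψ, rfl⟩
  obtain ⟨K, hK⟩ := FCD.exists_order_tensor T
  let b := Module.Basis.ofVectorSpace ℂ U
  -- One polynomial per basis vector carries the jets of φ at 1 and of ψ at 0, so a single
  -- differential map g replaces both points.
  choose f hf using fun i => exists_two_jets K
    (fun k => φ (FCD.jet k (b i)))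
    (fun k => ψ (FCD.jet k (b i)))
  let g : U →ₗ[ℂ] ℂ[X] := b.constr ℂ f
  have hg : ∀ (r : ℂ) (χ : FCD U →ₐ[ℂ] ℂ), (∀ i, ∀ k < K, (derivative^[k] (f i)).eval r =
      χ (FCD.jet k (b i))) → ∀ (u : U), ∀ k < K,
      χ (FCD.jet k u) =
      (aeval r).comp (FCD.toPolynomial g) (FCD.jet k u) := by
    intro r χ h u k hk
    have : χ.toLinearMap ∘ₗ FCD.jet k =
        ((aeval r).comp (FCD.toPolynomial g)).toLinearMap ∘ₗ FCD.jet k := by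
      refine b.ext fun i => ?_
      rw [LinearMap.comp_apply, LinearMap.comp_apply, AlgHom.toLinearMap_apply, ← h i k hk]
      simp [FCD.jet_apply, FCD.toPolynomial_ι_tmul, Module.End.pow_apply, g, b.constr_basis,
        coe_aeval_eq_eval]
    exact LinearMap.congr_fun this u
  change LinearMap.mul' ℂ ℂ (TensorProduct.map φ.toLinearMap ψ.toLinearMap T) = 0
  rw [hK φ _ ψ _ (hg 1 φ fun i k hk => (hf i k hk).1) (hg 0 ψ fun i k hk => (hf i k hk).2)]
  obtain ⟨N, hN⟩ := FCD.eval_one_tensor_eval_zero g T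
  rw [hN (N + 1) N.lt_succ_self]
  simp [hT]

end Points
end HopfAction

namespace HopfAction

open Coalgebra WithConv

/-! ### Commuting matrix coefficients. -/

section Symmetry

variable {U : Type*} [AddCommGroup U] [Module ℂ U] {H : Type*} [Ring H] [HopfAlgebra ℂ H]

/-- An action on `FCD(U)` commuting with the derivation satisfies `∑ h₁ a ⊗ h₂ b = ∑ h₂ a ⊗ h₁ b`. -/
theorem FCD.map_comul_eq_map_comm_comul (ρ : H →ₐ[ℂ] Module.End ℂ (FCD U))
    (hρ : IsModuleAlgebra ρ)
    (hcomm : ∀ (h : H) (a : FCD U), ρ h (FCD.deriv U a) = FCD.deriv U (ρ h a))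
    (h : H) (a b : FCD U) :
    TensorProduct.map (ρ.toLinearMap.flip a) (ρ.toLinearMap.flip b) (comul (R := ℂ) h) =
      TensorProduct.map (ρ.toLinearMap.flip a) (ρ.toLinearMap.flip b)
        (TensorProduct.comm ℂ H H (comul (R := ℂ) h)) := by
  have hiter : ∀ (n : ℕ) (x : H) (c : FCD U), ((FCD.deriv U).toLinearMap ^ n) (ρ x c) =
      ρ x (((FCD.deriv U).toLinearMap ^ n) c) := by
    intro n x c
    induction n with
    | zero => simp
    | succ n ih =>
      rw [pow_succ', Module.End.mul_apply, Module.End.mul_apply, ih]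
      exact (hcomm _ _).symm
  have hD : ∀ (n : ℕ) (t : H ⊗[ℂ] H), LinearMap.rTensor (FCD U) ((FCD.deriv U).toLinearMap ^ n)
      (TensorProduct.map (ρ.toLinearMap.flip a) (ρ.toLinearMap.flip b) t) =
      TensorProduct.map (ρ.toLinearMap.flip (((FCD.deriv U).toLinearMap ^ n) a))
        (ρ.toLinearMap.flip b) t := by
    intro n t
    induction t with
    | zero => simp
    | tmul x y => simp [hiter]
    | add x y hx hy => simp only [map_add, hx, hy]
  have hswap : ∀ (c : FCD U) (t : H ⊗[ℂ] H), LinearMap.mul' ℂ (FCD U)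
      (TensorProduct.map (ρ.toLinearMap.flip c) (ρ.toLinearMap.flip b)
        (TensorProduct.comm ℂ H H t)) =
      LinearMap.mul' ℂ (FCD U)
      (TensorProduct.map (ρ.toLinearMap.flip b) (ρ.toLinearMap.flip c) t) := by
    intro c t
    induction t with
    | zero => simp
    | tmul x y => simp [mul_comm]
    | add x y hx hy => simp only [map_add, hx, hy]
  rw [← sub_eq_zero]
  refine FCD.nondegenerate _ fun n => ?_
  -- The two terms are now h(∂ⁿ(a) b) and h(b ∂ⁿ(a)).
  rw [map_sub, map_sub, hD, hD, hswap, ← hρ.map_mul, ← hρ.map_mul, mul_comm, sub_self]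

end Symmetry

/-! ### Bi-ideals of finite-dimensional Hopf algebras. -/

section FiniteDimensional

/-- A subalgebra of a finite-dimensional algebra contains the inverses of its elements. -/
lemma mem_subalgebra_of_left_inverse {K E : Type*} [Field K] [Ring E] [Algebra K E]
    [FiniteDimensional K E] (W : Subalgebra K E) {x y : E} (hx : x ∈ W) (hyx : y * x = 1) : y ∈ W := by
  let L : W →ₗ[K] W := LinearMap.mulLeft K ⟨x, hx⟩
  have hinj : Function.Injective L := by
    intro u v huv
    have : x * (u : E) = x * v := congrArg Subtype.val huv
    ext
    rw [← one_mul (u : E), ← hyx, mul_assoc, this, ← mul_assoc, hyx, one_mul]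
  -- Finite dimension gives x a right inverse inside W, which must equal y.
  obtain ⟨z, hz⟩ := LinearMap.injective_iff_surjective.1 hinj 1
  have hz' : x * (z : E) = 1 := congrArg Subtype.val hz
  have : y = z := by rw [← mul_one y, ← hz', ← mul_assoc, hyx, one_mul]
  exact this ▸ z.2

end FiniteDimensional

section HopfIdeal

variable {K H : Type*} [Field K] [Ring H] [HopfAlgebra K H]

/-- The linear endomorphisms of `H` preserving a given two-sided ideal and coideal, as a
subalgebra of the convolution algebra. -/
noncomputable def convStabilizer (I : Ideal H) [I.IsTwoSided] (hI : (I.restrictScalars K).IsCoideal) :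
    Subalgebra K (WithConv (H →ₗ[K] H)) where
  carrier := {f | ∀ x ∈ I, f x ∈ I}
  mul_mem' := by
    intro f g hf hg x hx
    obtain ⟨s, ⟨s, rfl⟩, t, ⟨t, rfl⟩, hst⟩ := Submodule.mem_sup.1
      (((I.restrictScalars K).isCoideal_iff_comul_mem.1 hI).2 x hx)
    rw [LinearMap.convMul_apply, ← hst, map_add, map_add]
    -- Here s ∈ H ⊗ I is absorbed through g on the second leg, and t ∈ I ⊗ H through f on the first.
    refine I.add_mem ?_ ?_
    · clear hst
      induction s with
      | zero => simp
      | tmul u v => simpa using I.mul_mem_left _ (hg _ v.2)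
      | add u v hu hv => simpa only [map_add] using I.add_mem hu hv
    · clear hst
      induction t with
      | zero => simp
      | tmul u v => simpa using I.mul_mem_right _ (hf _ u.2)
      | add u v hu hv => simpa only [map_add] using I.add_mem hu hv
  add_mem' := fun hf hg x hx => I.add_mem (hf x hx) (hg x hx)
  algebraMap_mem' := by
    intro r x hx
    simp [hI.counit_eq_zero hx]

/-- In a finite-dimensional Hopf algebra every bi-ideal is a Hopf ideal. -/
theorem isHopfIdeal_of_isCoideal [FiniteDimensional K H] (I : Ideal H) [I.IsTwoSided]
    (hI : (I.restrictScalars K).IsCoideal) : I.IsHopfIdeal K where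
  toIsCoideal := hI
  antipode_mem := by
    have : FiniteDimensional K (WithConv (H →ₗ[K] H)) :=
      Module.Finite.equiv (WithConv.linearEquiv K (H →ₗ[K] H)).symm
    -- The antipode is the convolution inverse of the identity, which preserves I.
    exact mem_subalgebra_of_left_inverse (convStabilizer I hI) (x := toConv LinearMap.id)
      (y := toConv (HopfAlgebra.antipode K)) (fun x hx => hx)
      LinearMap.antipode_mul_id

end HopfIdeal

/-! ### The algebra of matrix coefficients and its common zeros. -/

section Coefficients

variable {K H A : Type*} [Field K] [Ring H] [HopfAlgebra K H] [AddCommGroup A] [Module K A]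

/-- The matrix coefficient `h ↦ φ(h a)` of a representation. -/
noncomputable def matrixCoeff (ρ : H →ₐ[K] Module.End K A) (φ : A →ₗ[K] K) (a : A) : WithConv (H →ₗ[K] K) :=
  toConv (φ ∘ₗ ρ.toLinearMap.flip a)

lemma matrixCoeff_apply (ρ : H →ₐ[K] Module.End K A) (φ : A →ₗ[K] K) (a : A) (h : H) :
    matrixCoeff ρ φ a h = φ (ρ h a) := rfl

/-- The subalgebra of the dual of `H` generated by the matrix coefficients. -/
noncomputable def coeffAlgebra (ρ : H →ₐ[K] Module.End K A) : Subalgebra K (WithConv (H →ₗ[K] K)) :=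
  Algebra.adjoin K {f | ∃ φ a, matrixCoeff ρ φ a = f}

variable (ρ : H →ₐ[K] Module.End K A)

lemma matrixCoeff_mem (φ : A →ₗ[K] K) (a : A) : matrixCoeff ρ φ a ∈ coeffAlgebra ρ :=
  Algebra.subset_adjoin ⟨φ, a, rfl⟩

/-- The algebra of matrix coefficients is stable under translations. -/
lemma translate_mem_coeffAlgebra {f : WithConv (H →ₗ[K] K)} (hf : f ∈ coeffAlgebra ρ) :
    ∀ x z : H, toConv (f.ofConv ∘ₗ LinearMap.mulLeftRight K (x, z)) ∈ coeffAlgebra ρ := by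
  induction hf using Algebra.adjoin_induction with
  | mem f hf =>
    obtain ⟨φ, a, rfl⟩ := hf
    intro x z
    convert matrixCoeff_mem ρ (φ ∘ₗ ρ x) (ρ z a) using 1
    ext h
    simp [matrixCoeff]
  | algebraMap r =>
    intro x z
    convert (coeffAlgebra ρ).algebraMap_mem (r * counit (R := K) x * counit (R := K) z) using 1
    ext h
    simp only [LinearMap.convAlgebraMap_apply, LinearMap.comp_apply, LinearMap.mulLeftRight_apply,
      Bialgebra.counit_mul, Algebra.algebraMap_self, RingHom.id_apply, smul_eq_mul]
    ring
  | add f g _ _ hf hg =>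
    intro x z
    exact (coeffAlgebra ρ).add_mem (hf x z) (hg x z)
  | mul f g _ _ hf hg =>
    intro x z
    -- Replacing Δx and Δz by arbitrary tensors allows reduction to pure ones, where a product of
    -- translates appears.
    have key : ∀ s t : H ⊗[K] H, toConv (LinearMap.mul' K K ∘ₗ
        TensorProduct.map f.ofConv g.ofConv ∘ₗ LinearMap.mulLeftRight K (s, t) ∘ₗ comul) ∈
        coeffAlgebra ρ := by
      intro s t
      induction s with
      | zero =>
        convert (coeffAlgebra ρ).zero_mem using 1
        ext h
        simp
      | add s₁ s₂ h₁ h₂ =>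
        convert (coeffAlgebra ρ).add_mem h₁ h₂ using 1
        ext h
        simp [add_mul]
      | tmul s₁ s₂ =>
        induction t with
        | zero =>
          convert (coeffAlgebra ρ).zero_mem using 1
          ext h
          simp
        | add t₁ t₂ h₁ h₂ =>
          convert (coeffAlgebra ρ).add_mem h₁ h₂ using 1
          ext h
          simp [mul_add]
        | tmul t₁ t₂ =>
          convert (coeffAlgebra ρ).mul_mem (hf s₁ t₁) (hg s₂ t₂) using 1
          ext h
          simp only [LinearMap.convMul_apply, LinearMap.comp_apply]
          generalize comul (R := K) h = w
          induction w with
          | zero => simp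
          | tmul u v => simp
          | add u v hu hv => simp only [map_add, hu, hv]
    convert key (comul x) (comul z) using 1
    ext h
    simp [LinearMap.convMul_apply]

/-- The common zeros of the algebra of matrix coefficients. -/
noncomputable def coeffIdeal : Ideal H where
  carrier := {h | ∀ f ∈ coeffAlgebra ρ, f h = 0}
  add_mem' := fun ha hb f hf => by rw [map_add, ha f hf, hb f hf, add_zero]
  zero_mem' := fun f _ => map_zero _
  smul_mem' := fun x h hh f hf => by
    simpa using hh _ (translate_mem_coeffAlgebra ρ hf x 1)

lemma mem_coeffIdeal {h : H} : h ∈ coeffIdeal ρ ↔ ∀ f ∈ coeffAlgebra ρ, f h = 0 := Iff.rfl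

instance : (coeffIdeal ρ).IsTwoSided where
  mul_mem_of_left z hh f hf := by
    simpa using hh _ (translate_mem_coeffAlgebra ρ hf 1 z)

/-- The algebra contains ε as its unit. Its elements descend to functionals separating the points of
H/I, and pairing Δx with two of them evaluates their convolution product at x, which is zero. -/
lemma isCoideal_coeffIdeal : ((coeffIdeal ρ).restrictScalars K).IsCoideal where
  counit_eq_zero x hx := by simpa using hx 1 (one_mem _)
  map_mkQ_comul_eq_zero x hx := by
    set I := (coeffIdeal ρ).restrictScalars K with hI
    have hle : ∀ f ∈ coeffAlgebra ρ, I ≤ LinearMap.ker f.ofConv := fun f hf h hh => hh f hf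
    let Φ : Set (H ⧸ I →ₗ[K] K) := {φ | toConv (φ ∘ₗ I.mkQ) ∈ coeffAlgebra ρ}
    have hΦ : ∀ v, (∀ φ ∈ Φ, φ v = 0) → v = 0 := by
      intro v hv
      obtain ⟨h, rfl⟩ := I.mkQ_surjective v
      rw [Submodule.mkQ_apply, Submodule.Quotient.mk_eq_zero]
      intro f hf
      have hmem : I.liftQ f.ofConv (hle f hf) ∈ Φ := by
        change toConv (I.liftQ f.ofConv (hle f hf) ∘ₗ I.mkQ) ∈ coeffAlgebra ρ
        rwa [Submodule.liftQ_mkQ]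
      simpa using hv _ hmem
    refine tensor_eq_zero_of_separating hΦ hΦ _ fun φ hφ ψ hψ => ?_
    rw [← LinearMap.comp_apply, ← LinearMap.comp_apply, ← LinearMap.comp_apply,
      LinearMap.comp_assoc, LinearMap.comp_assoc, ← LinearMap.comp_assoc _ _ (TensorProduct.map φ ψ),
      ← TensorProduct.map_comp]
    exact hx _ ((coeffAlgebra ρ).mul_mem hφ hψ)

lemma apply_eq_zero_of_mem_coeffIdeal {h : H} (hh : h ∈ coeffIdeal ρ) (a : A) : ρ h a = 0 :=
  (Module.forall_dual_apply_eq_zero_iff K _).1 fun φ => hh _ (matrixCoeff_mem ρ φ a)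

/-- If the matrix coefficients commute and have no common zeros, `H` is cocommutative. -/
theorem isCocomm_of_coeffIdeal_eq_bot (hbot : coeffIdeal ρ = ⊥)
    (hsymm : ∀ (h : H) (a b : A),
      TensorProduct.map (ρ.toLinearMap.flip a) (ρ.toLinearMap.flip b) (comul (R := K) h) =
      TensorProduct.map (ρ.toLinearMap.flip a) (ρ.toLinearMap.flip b)
        (TensorProduct.comm K H H (comul (R := K) h))) : IsCocomm K H where
  comm_comp_comul := by
    have hswap : ∀ (f g : H →ₗ[K] K) (t : H ⊗[K] H),
        LinearMap.mul' K K (TensorProduct.map f g (TensorProduct.comm K H H t)) =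
        LinearMap.mul' K K (TensorProduct.map g f t) := by
      intro f g t
      induction t with
      | zero => simp
      | tmul x y => simp [mul_comm]
      | add x y hx hy => simp only [map_add, hx, hy]
    have hgen : ∀ f ∈ {f | ∃ φ a, matrixCoeff ρ φ a = f},
        ∀ g ∈ {f | ∃ φ a, matrixCoeff ρ φ a = f}, f * g = g * f := by
      rintro _ ⟨φ, a, rfl⟩ _ ⟨ψ, b, rfl⟩
      ext h
      rw [LinearMap.convMul_apply, LinearMap.convMul_apply, ← hswap]
      simp only [matrixCoeff, TensorProduct.map_comp, LinearMap.comp_apply, hsymm]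
    have : IsMulCommutative (coeffAlgebra ρ) := Algebra.isMulCommutative_adjoin K hgen
    have hcomm : ∀ f ∈ coeffAlgebra ρ, ∀ g ∈ coeffAlgebra ρ, f * g = g * f := fun f hf g hg =>
      congrArg Subtype.val (mul_comm' (⟨f, hf⟩ : coeffAlgebra ρ) ⟨g, hg⟩)
    ext h
    rw [← sub_eq_zero]
    let Φ : Set (H →ₗ[K] K) := {φ | toConv φ ∈ coeffAlgebra ρ}
    have hΦ : ∀ v, (∀ φ ∈ Φ, φ v = 0) → v = 0 := by
      intro v hv
      have : v ∈ coeffIdeal ρ := fun f hf => hv f.ofConv hf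
      rwa [hbot] at this
    refine tensor_eq_zero_of_separating hΦ hΦ _ fun φ hφ ψ hψ => ?_
    rw [map_sub, map_sub, sub_eq_zero, LinearMap.comp_apply]
    refine (hswap φ ψ _).trans ?_
    exact LinearMap.congr_fun (congrArg ofConv (hcomm _ hψ _ hφ)) h

end Coefficients

end HopfAction

namespace HopfAction

open Coalgebra WithConv

/-! ### Cartier's theorem. -/

section CommutativeAlgebra

/-- The maximal ideals of a finite algebra over an algebraically closed field are the kernels of
its characters. -/
lemma exists_algHom_ker_eq {K R : Type*} [Field K] [IsAlgClosed K] [CommRing R] [Algebra K R]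
    [Module.Finite K R] (m : Ideal R) [m.IsMaximal] : ∃ χ : R →ₐ[K] K, RingHom.ker χ = m := by
  let _ : Field (R ⧸ m) := Ideal.Quotient.field m
  let ψ : (R ⧸ m) →ₐ[K] K := IsAlgClosed.lift
  refine ⟨ψ.comp (Ideal.Quotient.mkₐ K m), ?_⟩
  ext u
  rw [RingHom.mem_ker, AlgHom.comp_apply, map_eq_zero_iff ψ (RingHom.injective ψ.toRingHom)]
  exact Ideal.Quotient.eq_zero_iff_mem

/-- In a noetherian ring whose maximal ideals are idempotent the Jacobson radical vanishes. -/
lemma eq_zero_of_forall_mem_maximal {R : Type*} [CommRing R] [IsNoetherianRing R]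
    (hR : ∀ m : Ideal R, m.IsMaximal → IsIdempotentElem m) {a : R}
    (ha : ∀ m : Ideal R, m.IsMaximal → a ∈ m) : a = 0 := by
  by_contra ha0
  let N : Ideal R := (Ideal.span {a}).annihilator
  have hN : N ≠ ⊤ := by
    intro h0
    have h1 : (1 : R) ∈ N := h0 ▸ Submodule.mem_top
    exact ha0 (by simpa using Submodule.mem_annihilator.1 h1 a (Ideal.mem_span_singleton_self _))
  obtain ⟨m, hmax, hNm⟩ := Ideal.exists_le_maximal N hN
  obtain ⟨e, he, hme⟩ := (Ideal.isIdempotentElem_iff_of_fg m (IsNoetherian.noetherian m)).1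
    (hR m hmax)
  have hem : e ∈ m := by
    rw [hme]
    exact Ideal.mem_span_singleton_self e
  have ham := ha m hmax
  rw [hme] at ham
  obtain ⟨b, hb⟩ := Ideal.mem_span_singleton.1 ham
  -- Since a ∈ (e) and e is idempotent, ea = a; then both e and 1 - e lie in m.
  have h1e : 1 - e ∈ N := by
    refine Submodule.mem_annihilator.2 fun y hy => ?_
    obtain ⟨c, rfl⟩ := Ideal.mem_span_singleton.1 hy
    rw [smul_eq_mul, hb]
    linear_combination (-(b * c)) * he.eq
  apply hmax.ne_top
  rw [Ideal.eq_top_iff_one]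
  have := m.add_mem (hNm h1e) hem
  rwa [sub_add_cancel] at this

end CommutativeAlgebra

section Cocommutative

variable {K H : Type*} [Field K] [Ring H] [HopfAlgebra K H]

lemma comul_pow_of_primitive {x : H} (hx : comul (R := K) x = x ⊗ₜ 1 + 1 ⊗ₜ x) (n : ℕ) :
    comul (R := K) (x ^ n) =
      ∑ m ∈ Finset.range (n + 1), (n.choose m : K) • ((x ^ m) ⊗ₜ[K] (x ^ (n - m))) := by
  have hc : Commute (x ⊗ₜ[K] (1 : H)) ((1 : H) ⊗ₜ[K] x) := by
    simp [Commute, SemiconjBy]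
  rw [Bialgebra.comul_pow, hx, hc.add_pow]
  refine Finset.sum_congr rfl fun m _ => ?_
  rw [Algebra.TensorProduct.tmul_pow, Algebra.TensorProduct.tmul_pow, one_pow, one_pow,
    Algebra.TensorProduct.tmul_mul_tmul, one_mul, mul_one, ← Nat.cast_comm, ← nsmul_eq_mul,
    Nat.cast_smul_eq_nsmul]

variable [FiniteDimensional K H]

/-- A finite-dimensional Hopf algebra in characteristic zero has no nonzero primitive element. -/
theorem eq_zero_of_primitive [CharZero K] {x : H}
    (hx : comul (R := K) x = x ⊗ₜ 1 + 1 ⊗ₜ x) : x = 0 := by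
  nontriviality H
  have hcounit : counit (R := K) x = 0 := by
    have := congrArg (TensorProduct.lid K H) (rTensor_counit_comul (R := K) x)
    rw [hx] at this
    have h2 := congrArg (counit (R := K)) this
    simpa using h2
  have hint : IsIntegral K x := Algebra.IsIntegral.isIntegral x
  set n := (minpoly K x).natDegree with hn
  have hli : LinearIndependent K (fun i : Fin n => x ^ (i : ℕ)) := linearIndependent_pow x
  have hpos : 0 < n := minpoly.natDegree_pos hint
  obtain ⟨φ, hφ⟩ : ∃ φ : H →ₗ[K] K, ∀ i : Fin n, φ (x ^ (i : ℕ)) =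
      if (i : ℕ) = n - 1 then 1 else 0 := by
    obtain ⟨φ, hφ⟩ := LinearMap.exists_extend
      ((Module.Basis.span hli).constr K fun i : Fin n => if (i : ℕ) = n - 1 then (1 : K) else 0)
    refine ⟨φ, fun i => ?_⟩
    have h1 := LinearMap.congr_fun hφ (Module.Basis.span hli i)
    rw [Module.Basis.constr_basis] at h1
    simpa [Module.Basis.span_apply] using h1
  -- P = (φ ⊗ id)Δ, with φ reading off the coefficient of xⁿ⁻¹, sends xʲ to a scalar for j < n,
  -- hence also xⁿ by the minimal polynomial. Yet the binomial formula gives P(xⁿ) = nx + φ(xⁿ), so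
  -- x is a scalar.
  let P : H →ₗ[K] H := TensorProduct.lid K H ∘ₗ LinearMap.rTensor H φ ∘ₗ comul
  have hP : ∀ j, P (x ^ j) =
      ∑ m ∈ Finset.range (j + 1), ((j.choose m : K) * φ (x ^ m)) • x ^ (j - m) := by
    intro j
    simp [P, comul_pow_of_primitive hx, smul_smul]
  have hlow : ∀ j < n, P (x ^ j) ∈ K ∙ (1 : H) := by
    intro j hj
    rw [hP]
    refine Submodule.sum_mem _ fun m hm => ?_
    have hm' := Finset.mem_range.1 hm
    rw [hφ ⟨m, by omega⟩]
    by_cases h : m = n - 1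
    · have : j - m = 0 := by omega
      rw [this, pow_zero]
      exact Submodule.smul_mem _ _ (Submodule.mem_span_singleton_self _)
    · simp [h]
  have htop : P (x ^ n) ∈ K ∙ (1 : H) := by
    have h0 : (minpoly K x).sum (fun i c => c • P (x ^ i)) = 0 := by
      have := congrArg P (minpoly.aeval K x)
      rw [Polynomial.aeval_eq_sum_range] at this
      rw [Polynomial.sum_over_range _ (by simp)]
      simpa using this
    rw [Polynomial.sum_over_range _ (by simp), Finset.sum_range_succ, ← hn,
      (minpoly.monic hint).coeff_natDegree, one_smul, add_eq_zero_iff_eq_neg'] at h0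
    rw [h0]
    exact Submodule.neg_mem _ (Submodule.sum_mem _ fun i hi =>
      Submodule.smul_mem _ _ (hlow i (Finset.mem_range.1 hi)))
  have htop' : P (x ^ n) = (n : K) • x + φ (x ^ n) • 1 := by
    obtain ⟨k, hk⟩ : ∃ k, n = k + 1 := ⟨n - 1, by omega⟩
    rw [hP, Finset.sum_range_succ]
    rw [Finset.sum_eq_single (n - 1)]
    · rw [hφ ⟨n - 1, by omega⟩]
      simp [hk]
    · intro m hm hne
      rw [hφ ⟨m, Finset.mem_range.1 hm⟩]
      simp [hne]
    · intro h
      exact absurd (Finset.mem_range.2 (by omega)) h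
  have hxmem : x ∈ K ∙ (1 : H) := by
    have h1 : (n : K) • x ∈ K ∙ (1 : H) := by
      rw [← add_sub_cancel_right ((n : K) • x) (φ (x ^ n) • (1 : H)), ← htop']
      exact Submodule.sub_mem _ htop
        (Submodule.smul_mem _ _ (Submodule.mem_span_singleton_self _))
    have hn0 : (n : K) ≠ 0 := by exact_mod_cast hpos.ne'
    exact (Submodule.smul_mem_iff _ hn0).1 h1
  obtain ⟨c, rfl⟩ := Submodule.mem_span_singleton.1 hxmem
  have : c = 0 := by simpa using hcounit
  simp [this]

variable (K H) in
lemma dual_finite : FiniteDimensional K (WithConv (H →ₗ[K] K)) :=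
  Module.Finite.equiv (WithConv.linearEquiv K (H →ₗ[K] K)).symm

/-- Every functional on the dual of `H` is the evaluation at an element of `H`. -/
lemma exists_eval (d : WithConv (H →ₗ[K] K) →ₗ[K] K) : ∃ z : H, ∀ f, d f = f z := by
  obtain ⟨z, hz⟩ := (Module.evalEquiv K H).surjective
    (d ∘ₗ (WithConv.linearEquiv K (H →ₗ[K] K)).symm.toLinearMap)
  refine ⟨z, fun f => ?_⟩
  have := LinearMap.congr_fun hz f.ofConv
  simpa using this.symm

/-- Elements of `H ⊗ H` are determined by pairs of functionals on `H`. -/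
lemma tensor_ext {s t : H ⊗[K] H} (h : ∀ f g : H →ₗ[K] K, LinearMap.mul' K K
    (TensorProduct.map f g s) = LinearMap.mul' K K (TensorProduct.map f g t)) : s = t := by
  rw [← sub_eq_zero]
  have hΦ : ∀ v : H, (∀ φ ∈ (Set.univ : Set (H →ₗ[K] K)), φ v = 0) → v = 0 := fun v hv =>
    (Module.forall_dual_apply_eq_zero_iff K v).1 fun φ => hv φ trivial
  refine tensor_eq_zero_of_separating hΦ hΦ _ fun φ _ ψ _ => ?_
  rw [map_sub, map_sub, h, sub_self]

/-- A character of the dual of `H` is the evaluation at a group-like element. -/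
lemma exists_groupLike_of_algHom (χ : WithConv (H →ₗ[K] K) →ₐ[K] K) :
    ∃ g : H, IsGroupLikeElem K g ∧ ∀ f, χ f = f g := by
  obtain ⟨g, hg⟩ := exists_eval χ.toLinearMap
  refine ⟨g, ⟨?_, tensor_ext fun f f' => ?_⟩, hg⟩
  · have := hg 1
    simpa using this.symm
  · have := hg (toConv f * toConv f')
    rw [AlgHom.toLinearMap_apply, map_mul] at this
    have h1 := hg (toConv f)
    have h2 := hg (toConv f')
    rw [AlgHom.toLinearMap_apply] at h1 h2
    rw [h1, h2, LinearMap.convMul_apply] at this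
    simpa using this.symm

variable [IsCocomm K H]

/-- The kernel of a character of the dual of `H` is an idempotent ideal. -/
lemma isIdempotentElem_ker [CharZero K] (χ : WithConv (H →ₗ[K] K) →ₐ[K] K) :
    IsIdempotentElem (RingHom.ker χ) := by
  obtain ⟨g, hg, hχ⟩ := exists_groupLike_of_algHom χ
  set m := RingHom.ker χ with hm
  refine le_antisymm Ideal.mul_le_left fun a ha => ?_
  by_contra hna
  -- A functional killing m² and 1 but not a is a derivation at χ, that is, a nonzero tangent
  -- vector.
  let S : Submodule K (WithConv (H →ₗ[K] K)) := (m * m).restrictScalars K ⊔ K ∙ 1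
  have hSa : a ∉ S := by
    intro h
    obtain ⟨y, hy, z, hz, rfl⟩ := Submodule.mem_sup.1 h
    obtain ⟨c, rfl⟩ := Submodule.mem_span_singleton.1 hz
    have hy' : χ y = 0 := Ideal.mul_le_left hy
    have ha' : χ (y + c • 1) = 0 := ha
    rw [map_add, hy', zero_add, map_smul, map_one, smul_eq_mul, mul_one] at ha'
    apply hna
    rw [ha', zero_smul, add_zero]
    exact hy
  obtain ⟨d, hda, hd⟩ := Submodule.exists_le_ker_of_notMem hSa
  have hd1 : d 1 = 0 := hd (Submodule.mem_sup_right (Submodule.mem_span_singleton_self _))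
  have hdm : ∀ u ∈ m, ∀ v ∈ m, d (u * v) = 0 := fun u hu v hv =>
    hd (Submodule.mem_sup_left (Ideal.mul_mem_mul hu hv))
  have hder : ∀ u v, d (u * v) = χ u * d v + d u * χ v := by
    intro u v
    have h1 : u - χ u • 1 ∈ m := by simp [hm, RingHom.mem_ker]
    have h2 : v - χ v • 1 ∈ m := by simp [hm, RingHom.mem_ker]
    have h3 := hdm _ h1 _ h2
    simp only [mul_sub, sub_mul, smul_mul_assoc, mul_smul_comm, one_mul, mul_one, map_sub,
      map_smul, hd1, smul_eq_mul, mul_zero, sub_zero] at h3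
    linear_combination h3
  obtain ⟨z, hz⟩ := exists_eval d
  have hΔz : comul (R := K) z = g ⊗ₜ z + z ⊗ₜ g := by
    refine tensor_ext fun f f' => ?_
    have := hder (toConv f) (toConv f')
    rw [hz, hz, hz, hχ, hχ, LinearMap.convMul_apply] at this
    simpa using this
  have hS := hg.antipode
  -- Translation by g⁻¹ = S(g) turns the skew-primitive z into a primitive element.
  have hprim : HopfAlgebra.antipode K g * z = 0 := by
    refine eq_zero_of_primitive (K := K) ?_
    rw [Bialgebra.comul_mul, hS.comul_eq_tmul_self, hΔz, mul_add,
      Algebra.TensorProduct.tmul_mul_tmul, Algebra.TensorProduct.tmul_mul_tmul,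
      hg.antipode_mul_cancel, add_comm]
  have hz0 : z = 0 := by
    rw [← one_mul z, ← hg.mul_antipode_cancel, mul_assoc, hprim, mul_zero]
  apply hda
  rw [hz, hz0, map_zero]

/-- Cartier's theorem for finite-dimensional cocommutative Hopf algebras: such a Hopf algebra over
an algebraically closed field of characteristic zero is spanned by its group-like elements. -/
theorem span_groupLike_eq_top [CharZero K] [IsAlgClosed K] :
    Submodule.span K {g : H | IsGroupLikeElem K g} = ⊤ := by
  have := dual_finite K H
  by_contra hne
  obtain ⟨h, -, hh⟩ := SetLike.exists_of_lt (lt_top_iff_ne_top.2 hne)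
  obtain ⟨a, hah, ha⟩ := Submodule.exists_le_ker_of_notMem hh
  have : IsNoetherianRing (WithConv (H →ₗ[K] K)) := IsNoetherianRing.of_finite K _
  -- A functional vanishing on all group-likes lies in every maximal ideal of H*.
  have ha0 : toConv a = 0 := by
    refine eq_zero_of_forall_mem_maximal (fun m hm => ?_) fun m hm => ?_
    all_goals obtain ⟨χ, rfl⟩ := exists_algHom_ker_eq (K := K) m
    · exact isIdempotentElem_ker χ
    · obtain ⟨g, hg, hχ⟩ := exists_groupLike_of_algHom χ
      rw [RingHom.mem_ker, hχ]
      exact ha (Submodule.subset_span hg)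
  exact hah (LinearMap.congr_fun (congrArg ofConv ha0) h)

end Cocommutative

/-! ### Group algebras and the main theorem. -/

/-- A Hopf algebra spanned by its group-like elements is a group algebra. -/
theorem isGroupAlgebra_of_span_groupLike {H : Type*} [Ring H] [HopfAlgebra ℂ H]
    (hspan : Submodule.span ℂ {g : H | IsGroupLikeElem ℂ g} = ⊤) : IsGroupAlgebra H := by
  let F : MonoidAlgebra ℂ (GroupLike ℂ H) →ₐc[ℂ] H := MonoidAlgebra.liftGroupLikeBialgHom
  have hF : ∀ g r, F (MonoidAlgebra.single g r) = r • (g : H) := by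
    intro g r
    simp [F, MonoidAlgebra.liftGroupLikeBialgHom]
  have hlin : ∀ a, F a = Finsupp.linearCombination ℂ (GroupLike.val (R := ℂ) (A := H)) a.coeff := by
    intro a
    induction a using MonoidAlgebra.induction_linear with
    | zero => simp
    | add a b ha hb => simp [ha, hb]
    | single g r => simp [hF]
  have hbij : Function.Bijective F := by
    constructor
    · intro a b hab
      rw [hlin, hlin] at hab
      exact MonoidAlgebra.coeff_injective (linearIndep_groupLikeVal hab)
    · intro h
      have hh : h ∈ Submodule.span ℂ {g : H | IsGroupLikeElem ℂ g} := hspan ▸ Submodule.mem_top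
      induction hh using Submodule.span_induction with
      | mem g hg => exact ⟨MonoidAlgebra.single ⟨g, hg⟩ 1, by simp [hF]⟩
      | zero => exact ⟨0, map_zero F⟩
      | add x y _ _ hx hy =>
        obtain ⟨a, rfl⟩ := hx
        obtain ⟨b, rfl⟩ := hy
        exact ⟨a + b, map_add F a b⟩
      | smul c x _ hx =>
        obtain ⟨a, rfl⟩ := hx
        exact ⟨c • a, map_smul F c a⟩
  refine ⟨GroupLike ℂ H, inferInstance, BialgEquiv.ofBijective F hbij, fun a => ?_⟩
  change F (HopfAlgebra.antipode ℂ a) = HopfAlgebra.antipode ℂ (F a)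
  induction a using MonoidAlgebra.induction_linear with
  | zero => simp
  | add a b ha hb => simp only [map_add, ha, hb]
  | single g r => simp [hF, MonoidAlgebra.antipode_single]

end HopfAction

theorem corollary5p5
    {U : Type*} [AddCommGroup U] [Module ℂ U] (hU : Module.rank ℂ U ≤ Cardinal.aleph0)
    {H : Type*} [Ring H] [HopfAlgebra ℂ H] [FiniteDimensional ℂ H]
    (ρ : H →ₐ[ℂ] Module.End ℂ (HopfAction.FCD U))
    (hρ : HopfAction.IsModuleAlgebra ρ)
    (hfaithful : HopfAction.IsInnerFaithful ρ)
    (hcomm : ∀ (h : H) (a : HopfAction.FCD U),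
      ρ h (HopfAction.FCD.deriv U a) = HopfAction.FCD.deriv U (ρ h a)) :
    HopfAction.IsGroupAlgebra H := by
  have hbot : HopfAction.coeffIdeal ρ = ⊥ := by
    by_contra hne
    obtain ⟨h, hh, a, ha⟩ := hfaithful (HopfAction.coeffIdeal ρ) inferInstance
      (HopfAction.isHopfIdeal_of_isCoideal _ (HopfAction.isCoideal_coeffIdeal ρ)) hne
    exact ha (HopfAction.apply_eq_zero_of_mem_coeffIdeal ρ hh a)
  have := HopfAction.isCocomm_of_coeffIdeal_eq_bot ρ hbot
    (HopfAction.FCD.map_comul_eq_map_comm_comul ρ hρ hcomm)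
  exact HopfAction.isGroupAlgebra_of_span_groupLike HopfAction.span_groupLike_eq_top
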